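/- A \emph{compactology} on a set $X$ is a non-empty collection $\mathscr{C}$ of subsets of $X$ together with, for each $K\in\mathscr{C}$, a compact Hausdorff topology $\tau_K$ on $K$, such that: (1) $\bigcup_{K\in\mathscr{C}}K=X$; (2) for all $K_1,K_2\in\mathscr{C}$ there is $K_3\in\mathscr{C}$ with $K_1\cup K_2\subseteq K_3$; (3) if $K_1,K_2\in\mathscr{C}$ and $K_2\subseteq K_1$, then $\tau_{K_2}$ is the subspace topology induced by $\tau_{K_1}$; (4) if $K_1\in\mathscr{C}$ and $K_2\subseteq K_1$ is compact in $(K_1,\tau_{K_1})$, then $K_2\in\mathscr{C}$. A \emph{compactological set} is a set equipped with a compactology. A morphism $(X,\mathscr{C},(\tau_K)_{K\in\mathscr{C}})\to(X',\mathscr{C}',(\tau_{K'})_{K'\in\mathscr{C}'})$ is a map $f\colon X\to X'$ such that for every $K\in\mathscr{C}$ one has $f(K)\in\mathscr{C}'$ and $f|_K\colon(K,\tau_K)\to(f(K),\tau_{f(K)})$ is continuous. Compactological sets and their morphisms form a category $\mathsf{Cmp}$. \textbf{Lemma.} The category $\mathsf{Cmp}$ is regular, that is: (i) $\mathsf{Cmp}$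 has all finite limits; (ii) for every morphism $f\colon C\to D$ the kernel pair $C\times_D C\rightrightarrows C$ has a coequalizer; (iii) regular epimorphisms (morphisms that are a coequalizer of some parallel pair) are stable under pullback along arbitrary morphisms. -/

import Mathlib

open CategoryTheory

universe u

/-- A compactology on a set `X`: a non-empty collection `sets` of subsets of `X`, each endowed
with a compact Hausdorff topology, which covers `X`, is upwards filtering, carries coherent
topologies and is stable under compact subsets. -/
structure Compactology (X : Type u) where
  /-- The members of the compactology. -/
  sets : Set (Set X)
  /-- The topology carried by a member. -/
  top : ∀ K ∈ sets, TopologicalSpace K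
  nonempty : sets.Nonempty
  compactSpace : ∀ (K : Set X) (hK : K ∈ sets), @CompactSpace K (top K hK)
  t2Space : ∀ (K : Set X) (hK : K ∈ sets), @T2Space K (top K hK)
  covering : ⋃₀ sets = Set.univ
  filtering : ∀ K₁ ∈ sets, ∀ K₂ ∈ sets, ∃ K₃ ∈ sets, K₁ ⊆ K₃ ∧ K₂ ⊆ K₃
  coherent : ∀ (K₁ : Set X) (hK₁ : K₁ ∈ sets) (K₂ : Set X) (hK₂ : K₂ ∈ sets) (h : K₂ ⊆ K₁),
    top K₂ hK₂ = TopologicalSpace.induced (Set.inclusion h) (top K₁ hK₁)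
  stable : ∀ (K₁ : Set X) (hK₁ : K₁ ∈ sets) (A : Set K₁),
    @IsCompact K₁ (top K₁ hK₁) A → Subtype.val '' A ∈ sets

/-- `f` maps members of `𝒞` onto members of `𝒟`, and its restriction to every member of `𝒞`
is continuous as a map onto its image. -/
structure Compactology.IsMorphism {X Y : Type u} (𝒞 : Compactology X) (𝒟 : Compactology Y)
    (f : X → Y) : Prop where
  image_mem : ∀ K ∈ 𝒞.sets, f '' K ∈ 𝒟.sets
  continuous : ∀ (K : Set X) (hK : K ∈ 𝒞.sets),
    @Continuous K (f '' K : Set Y) (𝒞.top K hK) (𝒟.top (f '' K) (image_mem K hK))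
      ((Set.mapsTo_image f K).restrict f K (f '' K))

namespace Compactology

theorem continuous_of_eq {X Y : Type u} {𝒞 : Compactology X} {𝒟 : Compactology Y}
    {f : X → Y} (K : Set X) (hK : K ∈ 𝒞.sets) (L : Set Y)
    (hL : L ∈ 𝒟.sets) (h : L = f '' K) (hm : Set.MapsTo f K L)
    (hc : @Continuous K L (𝒞.top K hK) (𝒟.top L hL) (hm.restrict f K L))
    (hL' : f '' K ∈ 𝒟.sets) :
    @Continuous K (f '' K : Set Y) (𝒞.top K hK) (𝒟.top (f '' K) hL')
      ((Set.mapsTo_image f K).restrict f K (f '' K)) := by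
  subst h
  exact hc

theorem isMorphism_id {X : Type u} (𝒞 : Compactology X) : 𝒞.IsMorphism 𝒞 id := by
  have him : ∀ K ∈ 𝒞.sets, id '' K ∈ 𝒞.sets := fun K hK => by rwa [Set.image_id]
  refine ⟨him, fun K hK => ?_⟩
  refine continuous_of_eq K hK K hK (Set.image_id K).symm (Set.mapsTo_id K) ?_ (him K hK)
  exact @continuous_id K (𝒞.top K hK)

theorem IsMorphism.comp {X Y Z : Type u} {𝒞 : Compactology X} {𝒟 : Compactology Y}
    {ℰ : Compactology Z} {g : Y → Z} {f : X → Y} (hg : 𝒟.IsMorphism ℰ g)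
    (hf : 𝒞.IsMorphism 𝒟 f) : 𝒞.IsMorphism ℰ (g ∘ f) := by
  have him : ∀ K ∈ 𝒞.sets, g ∘ f '' K ∈ ℰ.sets := fun K hK => by
    rw [Set.image_comp]
    exact hg.image_mem _ (hf.image_mem K hK)
  refine ⟨him, fun K hK => ?_⟩
  refine continuous_of_eq K hK (g '' (f '' K)) (hg.image_mem _ (hf.image_mem K hK))
    (Set.image_comp g f K).symm ((Set.mapsTo_image g _).comp (Set.mapsTo_image f K)) ?_ (him K hK)
  exact @Continuous.comp K (f '' K : Set Y) (g '' (f '' K) : Set Z) (𝒞.top K hK)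
    (𝒟.top _ (hf.image_mem K hK)) (ℰ.top _ (hg.image_mem _ (hf.image_mem K hK))) _ _
    (hg.continuous _ (hf.image_mem K hK)) (hf.continuous K hK)

end Compactology

/-- A compactological set: a set together with a compactology on it. -/
structure Cmp : Type (u + 1) where
  carrier : Type u
  compactology : Compactology carrier

namespace Cmp

/-- Morphisms of compactological sets. -/
@[ext]
structure Hom (C D : Cmp.{u}) : Type u where
  toFun : C.carrier → D.carrier
  isMorphism : C.compactology.IsMorphism D.compactology toFun

/-- The category of compactological sets. -/
instance : Category Cmp.{u} where
  Hom := Hom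
  id C := ⟨id, C.compactology.isMorphism_id⟩
  comp f g := ⟨g.toFun ∘ f.toFun, g.isMorphism.comp f.isMorphism⟩

end Cmp

-- A morphism is a regular epimorphism exactly when every member of the target is the image of a
-- member of the source (`isRegularEpi_iff_liftsMembers`). Every morphism factors as such a map
-- followed by a monomorphism (`toImage`, `imageι`), and such a map is the coequalizer of its kernel
-- pair, because a continuous surjection from a compact space to a Hausdorff space is a quotient
-- map. Stability under pullback becomes a statement about members: if `g(L) = f(K)`, then the fibre
-- product of `K` and `L` over `g(L)` is compact and maps onto `L`. Limits and images come from one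
-- construction, `PlotData`: the members are the ranges of plots with compact source, topologized by
-- the projections.

universe v w

namespace Compactology

/-! ### Admissible maps -/

section Admissible

variable {X : Type u} {Y : Type u} {𝒞 : Compactology X} {𝒟 : Compactology Y}

/-- A map from a topological space to a compactological set is admissible if it factors as a
continuous map through some member of the compactology. -/
def Admissible (𝒞 : Compactology X) {A : Type v} [TopologicalSpace A] (φ : A → X) : Prop :=
  ∃ (K : Set X) (hK : K ∈ 𝒞.sets) (h : ∀ a, φ a ∈ K),
    @Continuous A K _ (𝒞.top K hK) fun a => ⟨φ a, h a⟩

theorem empty_mem (𝒞 : Compactology X) : ∅ ∈ 𝒞.sets := by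
  obtain ⟨K, hK⟩ := 𝒞.nonempty
  let := 𝒞.top K hK
  simpa using 𝒞.stable K hK ∅ isCompact_empty

theorem exists_mem (𝒞 : Compactology X) (x : X) : ∃ K ∈ 𝒞.sets, x ∈ K := by
  have : x ∈ ⋃₀ 𝒞.sets := 𝒞.covering ▸ Set.mem_univ x
  exact this

theorem admissible_val (K : Set X) (hK : K ∈ 𝒞.sets) :
    @Admissible X 𝒞 K (𝒞.top K hK) Subtype.val := by
  let := 𝒞.top K hK
  exact ⟨K, hK, fun a => a.2, continuous_id⟩

theorem admissible_of_isEmpty {A : Type v} [TopologicalSpace A] [IsEmpty A] (φ : A → X) :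
    𝒞.Admissible φ :=
  let := 𝒞.top ∅ 𝒞.empty_mem
  ⟨∅, 𝒞.empty_mem, isEmptyElim, continuous_of_const fun a => isEmptyElim a⟩

theorem admissible_const {A : Type v} [TopologicalSpace A] (x : X) :
    𝒞.Admissible fun _ : A => x := by
  obtain ⟨K, hK, hx⟩ := 𝒞.exists_mem x
  let := 𝒞.top K hK
  exact ⟨K, hK, fun _ => hx, continuous_const⟩

namespace Admissible

variable {A : Type v} [TopologicalSpace A] {φ : A → X}

/-- Two members lie in a common third one whose topology induces both of theirs, so continuity does
not depend on the member chosen as codomain. -/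
theorem continuous_codRestrict (hφ : 𝒞.Admissible φ) (L : Set X) (hL : L ∈ 𝒞.sets)
    (h : ∀ a, φ a ∈ L) : @Continuous A L _ (𝒞.top L hL) fun a => ⟨φ a, h a⟩ := by
  obtain ⟨K, hK, hφK, hc⟩ := hφ
  obtain ⟨M, hM, hKM, hLM⟩ := 𝒞.filtering K hK L hL
  let := 𝒞.top M hM
  rw [𝒞.coherent M hM K hK hKM, continuous_induced_rng] at hc
  rw [𝒞.coherent M hM L hL hLM, continuous_induced_rng]
  exact hc

theorem range_mem [CompactSpace A] (hφ : 𝒞.Admissible φ) : Set.range φ ∈ 𝒞.sets := by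
  obtain ⟨K, hK, hφK, hc⟩ := hφ
  let := 𝒞.top K hK
  have := 𝒞.stable K hK _ (isCompact_range hc)
  rwa [← Set.range_comp] at this

theorem comp (hφ : 𝒞.Admissible φ) {B : Type w} [TopologicalSpace B] {g : B → A}
    (hg : Continuous g) : 𝒞.Admissible (φ ∘ g) := by
  obtain ⟨K, hK, hφK, hc⟩ := hφ
  let := 𝒞.top K hK
  exact ⟨K, hK, fun b => hφK (g b), hc.comp hg⟩

theorem sumElim (hφ : 𝒞.Admissible φ) {B : Type w} [TopologicalSpace B] {ψ : B → X}
    (hψ : 𝒞.Admissible ψ) : 𝒞.Admissible (Sum.elim φ ψ) := by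
  obtain ⟨K, hK, hφK, -⟩ := id hφ
  obtain ⟨L, hL, hψL, -⟩ := id hψ
  obtain ⟨M, hM, hKM, hLM⟩ := 𝒞.filtering K hK L hL
  have h : ∀ a, Sum.elim φ ψ a ∈ M := by
    rintro (a | b)
    exacts [hKM (hφK a), hLM (hψL b)]
  let := 𝒞.top M hM
  refine ⟨M, hM, h, continuous_sum_dom.2 ⟨?_, ?_⟩⟩
  · exact hφ.continuous_codRestrict M hM _
  · exact hψ.continuous_codRestrict M hM _

end Admissible

theorem IsMorphism.admissible_comp {f : X → Y} (hf : 𝒞.IsMorphism 𝒟 f) {A : Type v}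
    [TopologicalSpace A] {φ : A → X} (hφ : 𝒞.Admissible φ) : 𝒟.Admissible (f ∘ φ) := by
  obtain ⟨K, hK, hφK, hc⟩ := hφ
  let := 𝒞.top K hK
  let := 𝒟.top _ (hf.image_mem K hK)
  exact ⟨f '' K, hf.image_mem K hK, fun a => Set.mem_image_of_mem f (hφK a),
    (hf.continuous K hK).comp hc⟩

theorem isMorphism_of_admissible {f : X → Y}
    (h : ∀ (K : Set X) (hK : K ∈ 𝒞.sets), @Admissible Y 𝒟 K (𝒞.top K hK) (f ∘ Subtype.val)) :
    𝒞.IsMorphism 𝒟 f := by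
  have him : ∀ K ∈ 𝒞.sets, f '' K ∈ 𝒟.sets := fun K hK => by
    let := 𝒞.top K hK
    have := 𝒞.compactSpace K hK
    have := (h K hK).range_mem
    rwa [Set.range_comp, Subtype.range_val] at this
  refine ⟨him, fun K hK => ?_⟩
  let := 𝒞.top K hK
  exact (h K hK).continuous_codRestrict _ (him K hK) fun a => Set.mem_image_of_mem f a.2

/-- A map out of the target of a morphism which lifts every member to a member is a morphism as
soon as its composite with that morphism is. -/
theorem IsMorphism.of_comp {Z : Type u} {ℰ : Compactology Z} {f : X → Y} {k : Y → Z}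
    (hf : 𝒞.IsMorphism 𝒟 f) (hs : ∀ L ∈ 𝒟.sets, ∃ K ∈ 𝒞.sets, f '' K = L)
    (hk : 𝒞.IsMorphism ℰ (k ∘ f)) : 𝒟.IsMorphism ℰ k := by
  refine isMorphism_of_admissible fun L hL => ?_
  obtain ⟨K, hK, rfl⟩ := hs L hL
  let := 𝒞.top K hK
  let := 𝒟.top _ hL
  have := 𝒞.compactSpace K hK
  have := 𝒟.t2Space _ hL
  have hM : k ∘ f '' K ∈ ℰ.sets := hk.image_mem K hK
  let := ℰ.top _ hM
  -- Compact source and Hausdorff target make the restriction of `f` a closed map.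
  have hq : Topology.IsQuotientMap ((Set.mapsTo_image f K).restrict f K (f '' K)) := by
    refine (hf.continuous K hK).isClosedMap.isQuotientMap (hf.continuous K hK) ?_
    exact Set.surjective_mapsTo_image_restrict f K
  refine ⟨_, hM, fun a => ?_, hq.continuous_iff.2 (hk.continuous K hK)⟩
  rw [Set.image_comp]
  exact Set.mem_image_of_mem k a.2

end Admissible

/-- The compactology of all compact subsets of a compact Hausdorff space. -/
def ofCompactHausdorff (A : Type u) [TopologicalSpace A] [CompactSpace A] [T2Space A] :
    Compactology A where
  sets := {K | IsCompact K}
  top _ _ := instTopologicalSpaceSubtype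
  nonempty := ⟨∅, isCompact_empty⟩
  compactSpace _ hK := isCompact_iff_compactSpace.1 hK
  t2Space _ _ := inferInstance
  covering := Set.eq_univ_of_forall fun x => ⟨{x}, isCompact_singleton, rfl⟩
  filtering K hK L hL :=
    ⟨K ∪ L, IsCompact.union hK hL, Set.subset_union_left, Set.subset_union_right⟩
  coherent _ _ _ _ h := (Topology.IsEmbedding.inclusion h).eq_induced
  stable _ _ _ hA := hA.image continuous_subtype_val

theorem isMorphism_ofCompactHausdorff {A : Type u} [TopologicalSpace A] [CompactSpace A]
    [T2Space A] {X : Type u} {𝒞 : Compactology X} {φ : A → X} (hφ : 𝒞.Admissible φ) :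
    (ofCompactHausdorff A).IsMorphism 𝒞 φ :=
  isMorphism_of_admissible fun K hK =>
    let := (ofCompactHausdorff A).top K hK
    hφ.comp (continuous_induced_dom (f := (Subtype.val : K → A)))

/-- A class of maps from compact spaces to a set `Z`, closed under the operations
needed to generate a compactology, together with a jointly injective family of maps to
compactological sets sending the maps of the class to admissible ones. -/
structure PlotData (Z : Type u) where
  ι : Type v
  space : ι → Type u
  compactology : ∀ i, Compactology (space i)
  proj : ∀ i, Z → space i
  ext : ∀ z z', (∀ i, proj i z = proj i z') → z = z'
  IsPlot : ∀ (A : Type u) [TopologicalSpace A], (A → Z) → Prop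
  isEmpty : ∀ (A : Type u) [TopologicalSpace A] [IsEmpty A] (φ : A → Z), IsPlot A φ
  const : ∀ (A : Type u) [TopologicalSpace A] (z : Z), IsPlot A fun _ => z
  comp : ∀ (A B : Type u) [TopologicalSpace A] [TopologicalSpace B] (φ : A → Z) (g : B → A),
    IsPlot A φ → Continuous g → IsPlot B (φ ∘ g)
  sumElim : ∀ (A B : Type u) [TopologicalSpace A] [TopologicalSpace B] (φ : A → Z) (ψ : B → Z),
    IsPlot A φ → IsPlot B ψ → IsPlot (A ⊕ B) (Sum.elim φ ψ)
  admissible : ∀ (A : Type u) [TopologicalSpace A] (φ : A → Z), IsPlot A φ →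
    ∀ i, (compactology i).Admissible (proj i ∘ φ)

/-! ### Compactologies generated by plots -/

namespace PlotData

variable {Z : Type u} (P : PlotData.{u, v} Z)

/-- The ranges of the plots with compact source. -/
def sets : Set (Set Z) :=
  {S | ∃ (A : Type u) (_ : TopologicalSpace A) (_ : CompactSpace A) (φ : A → Z),
    P.IsPlot A φ ∧ Set.range φ = S}

variable {P} in
theorem image_mem {S : Set Z} (hS : S ∈ P.sets) (i : P.ι) :
    P.proj i '' S ∈ (P.compactology i).sets := by
  obtain ⟨A, _, _, φ, hφ, rfl⟩ := hS
  rw [← Set.range_comp]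
  exact (P.admissible A φ hφ i).range_mem

/-- The topology on a member induced by all projections. -/
abbrev top (S : Set Z) (hS : S ∈ P.sets) : TopologicalSpace S :=
  ⨅ i, .induced ((Set.mapsTo_image (P.proj i) S).restrict _ _ _)
    ((P.compactology i).top _ (image_mem hS i))

theorem continuous_top {A : Type u} [TopologicalSpace A] {φ : A → Z} (hφ : P.IsPlot A φ)
    (S : Set Z) (hS : S ∈ P.sets) (h : ∀ a, φ a ∈ S) :
    @Continuous A S _ (P.top S hS) fun a => ⟨φ a, h a⟩ := by
  refine continuous_iInf_rng.2 fun i => continuous_induced_rng.2 ?_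
  exact (P.admissible A φ hφ i).continuous_codRestrict _ (image_mem hS i)
    fun a => Set.mem_image_of_mem _ (h a)

/-- The projections are jointly injective, so distinct points are already separated in some
Hausdorff image. -/
theorem t2Space_top (S : Set Z) (hS : S ∈ P.sets) : @T2Space S (P.top S hS) := by
  let := P.top S hS
  refine ⟨fun s t hst => ?_⟩
  obtain ⟨i, hi⟩ : ∃ i, P.proj i s ≠ P.proj i t := by
    by_contra! h
    exact hst (Subtype.ext (P.ext _ _ h))
  let := (P.compactology i).top _ (image_mem hS i)
  have := (P.compactology i).t2Space _ (image_mem hS i)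
  have hc : Continuous ((Set.mapsTo_image (P.proj i) S).restrict _ _ _) :=
    continuous_iff_le_induced.2 (iInf_le _ i)
  exact separated_by_continuous hc fun h => hi (congrArg Subtype.val h)

/-- The compactology whose members are the ranges of the plots with compact source. -/
def toCompactology : Compactology Z where
  sets := P.sets
  top := P.top
  nonempty := ⟨_, PEmpty, ⊥, inferInstance, PEmpty.elim,
    let : TopologicalSpace PEmpty := ⊥; P.isEmpty _ _, rfl⟩
  compactSpace S hS := by
    obtain ⟨A, _, _, φ, hφ, rfl⟩ := id hS
    let := P.top _ hS
    have hc := P.continuous_top hφ _ hS Set.mem_range_self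
    refine ⟨?_⟩
    rw [← (Set.rangeFactorization_surjective (f := φ)).range_eq]
    exact isCompact_range hc
  t2Space := P.t2Space_top
  covering := Set.eq_univ_of_forall fun z =>
    ⟨_, ⟨PUnit, ⊥, inferInstance, fun _ => z,
      let : TopologicalSpace PUnit := ⊥; P.const _ z, rfl⟩, ⟨⟩, rfl⟩
  filtering := by
    rintro _ ⟨A, _, _, φ, hφ, rfl⟩ _ ⟨B, _, _, ψ, hψ, rfl⟩
    refine ⟨_, ⟨A ⊕ B, inferInstance, inferInstance, _, P.sumElim A B φ ψ hφ hψ, rfl⟩, ?_, ?_⟩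
    · rintro _ ⟨a, rfl⟩
      exact ⟨.inl a, rfl⟩
    · rintro _ ⟨b, rfl⟩
      exact ⟨.inr b, rfl⟩
  coherent S hS T hT h := by
    simp only [top, induced_iInf, induced_compose]
    refine iInf_congr fun i => ?_
    rw [(P.compactology i).coherent _ (image_mem hS i) _ (image_mem hT i) (Set.image_mono h),
      induced_compose]
    rfl
  stable S hS T hT := by
    obtain ⟨A, _, _, φ, hφ, rfl⟩ := id hS
    let := P.top _ hS
    have := P.t2Space_top _ hS
    have hc := P.continuous_top hφ _ hS Set.mem_range_self
    -- A compact `T` is closed, so its preimage in the compact source is compact; the plot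
    -- restricted to it has range `T`.
    have hcl : IsClosed ((fun a => (⟨φ a, Set.mem_range_self a⟩ : Set.range φ)) ⁻¹' T) :=
      hT.isClosed.preimage hc
    refine ⟨_, inferInstance, isCompact_iff_compactSpace.1 hcl.isCompact, φ ∘ Subtype.val,
      P.comp _ _ φ _ hφ continuous_subtype_val, ?_⟩
    ext z
    constructor
    · rintro ⟨⟨a, ha⟩, rfl⟩
      exact ⟨_, ha, rfl⟩
    · rintro ⟨⟨_, a, rfl⟩, ha, rfl⟩
      exact ⟨⟨a, ha⟩, rfl⟩

theorem admissible_of_isPlot {A : Type u} [TopologicalSpace A] [CompactSpace A] {φ : A → Z}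
    (hφ : P.IsPlot A φ) : P.toCompactology.Admissible φ :=
  have hS : Set.range φ ∈ P.sets := ⟨A, inferInstance, inferInstance, φ, hφ, rfl⟩
  ⟨_, hS, Set.mem_range_self, P.continuous_top hφ _ hS _⟩

theorem isMorphism_proj (i : P.ι) :
    P.toCompactology.IsMorphism (P.compactology i) (P.proj i) :=
  ⟨fun _ hS => image_mem hS i, fun _ _ => continuous_iff_le_induced.2 (iInf_le _ i)⟩

theorem isMorphism_of_isPlot {X : Type u} {𝒞 : Compactology X} {f : X → Z}
    (h : ∀ (K : Set X) (hK : K ∈ 𝒞.sets), @IsPlot _ P K (𝒞.top K hK) (f ∘ Subtype.val)) :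
    𝒞.IsMorphism P.toCompactology f :=
  isMorphism_of_admissible fun K hK =>
    let := 𝒞.top K hK
    have := 𝒞.compactSpace K hK
    P.admissible_of_isPlot (h K hK)

end PlotData

end Compactology

open CategoryTheory.Limits

namespace Cmp

@[ext]
theorem hom_ext {C D : Cmp.{u}} {f g : C ⟶ D} (h : ∀ x, f.toFun x = g.toFun x) : f = g :=
  Hom.ext (funext h)

theorem congr_toFun {C D : Cmp.{u}} {f g : C ⟶ D} (h : f = g) (x : C.carrier) :
    f.toFun x = g.toFun x := by
  rw [h]

/-! ### Finite limits -/

section FiniteLimits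

variable {J : Type} [SmallCategory J] (F : J ⥤ Cmp.{u})

/-- The compatible families of points of a diagram, with the class of maps all of whose components
are admissible. -/
def limitPlotData : Compactology.PlotData.{u, 0}
    {x : ∀ j, (F.obj j).carrier // ∀ ⦃i j⦄ (f : i ⟶ j), (F.map f).toFun (x i) = x j} where
  ι := J
  space j := (F.obj j).carrier
  compactology j := (F.obj j).compactology
  proj j x := x.1 j
  ext _ _ h := Subtype.ext (funext h)
  IsPlot A _ φ := ∀ j, (F.obj j).compactology.Admissible fun a : A => (φ a).1 j
  isEmpty _ _ _ _ _ := Compactology.admissible_of_isEmpty _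
  const _ _ _ _ := Compactology.admissible_const _
  comp _ _ _ _ _ _ hφ hg j := (hφ j).comp hg
  sumElim _ _ _ _ φ ψ hφ hψ j := by
    convert (hφ j).sumElim (hψ j) using 1
    ext (a | b) <;> rfl
  admissible _ _ _ hφ j := hφ j

/-- The limit cone of a diagram of compactological sets. -/
def limitCone : Cone F where
  pt := ⟨_, (limitPlotData F).toCompactology⟩
  π :=
    { app := fun j => ⟨fun x => x.1 j, (limitPlotData F).isMorphism_proj j⟩
      naturality := fun _ _ f => hom_ext fun x => (x.2 f).symm }

/-- The cone `limitCone` is a limit. -/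
def limitConeIsLimit : IsLimit (limitCone F) where
  lift s :=
    ⟨fun x => ⟨fun j => (s.π.app j).toFun x, fun _ _ f => congr_toFun (s.w f) x⟩,
      (limitPlotData F).isMorphism_of_isPlot fun K hK j =>
        let := s.pt.compactology.top K hK
        (s.π.app j).isMorphism.admissible_comp (Compactology.admissible_val K hK)⟩
  fac _ _ := rfl
  uniq _ _ h := hom_ext fun x => Subtype.ext (funext fun j => congr_toFun (h j) x)

instance : HasFiniteLimits Cmp.{u} where
  out _ _ _ := ⟨fun F => ⟨⟨⟨limitCone F, limitConeIsLimit F⟩⟩⟩⟩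

end FiniteLimits

/-- A compact Hausdorff space as a compactological set. -/
def ofCompactHausdorff (A : Type u) [TopologicalSpace A] [CompactSpace A] [T2Space A] : Cmp.{u} :=
  ⟨A, Compactology.ofCompactHausdorff A⟩

/-- The morphism given by an admissible map. -/
def ofAdmissible {A : Type u} [TopologicalSpace A] [CompactSpace A] [T2Space A] {C : Cmp.{u}}
    (φ : A → C.carrier) (hφ : C.compactology.Admissible φ) : ofCompactHausdorff A ⟶ C :=
  ⟨φ, Compactology.isMorphism_ofCompactHausdorff (A := A) hφ⟩

/-- Points are morphisms from the one-point space, to which the universal property applies. -/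
theorem exists_of_isPullback {P C D E : Cmp.{u}} {p : P ⟶ C} {q : P ⟶ D} {f : C ⟶ E} {g : D ⟶ E}
    (h : IsPullback p q f g) {x : C.carrier} {y : D.carrier} (hxy : f.toFun x = g.toFun y) :
    ∃ z, p.toFun z = x ∧ q.toFun z = y := by
  let a : ofCompactHausdorff PUnit ⟶ C := ofAdmissible _ (Compactology.admissible_const x)
  let b : ofCompactHausdorff PUnit ⟶ D := ofAdmissible _ (Compactology.admissible_const y)
  have hab : a ≫ f = b ≫ g := hom_ext fun _ => hxy
  exact ⟨(h.lift a b hab).toFun ⟨⟩, congr_toFun (h.lift_fst a b hab) ⟨⟩,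
    congr_toFun (h.lift_snd a b hab) ⟨⟩⟩

/-- A morphism lifts members if every member of the target is the image of a member of the
source. -/
def LiftsMembers {C D : Cmp.{u}} (f : C ⟶ D) : Prop :=
  ∀ L ∈ D.compactology.sets, ∃ K ∈ C.compactology.sets, f.toFun '' K = L

theorem LiftsMembers.surjective {C D : Cmp.{u}} {f : C ⟶ D} (hf : LiftsMembers f) :
    Function.Surjective f.toFun := fun y => by
  obtain ⟨L, hL, hy⟩ := D.compactology.exists_mem y
  obtain ⟨K, -, rfl⟩ := hf L hL
  obtain ⟨x, -, hx⟩ := hy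
  exact ⟨x, hx⟩

/-- A morphism which lifts members and coequalizes enough pairs is a coequalizer. -/
noncomputable def LiftsMembers.isColimit {B C D : Cmp.{u}} {f : C ⟶ D} (hf : LiftsMembers f)
    {a b : B ⟶ C} (w : a ≫ f = b ≫ f)
    (h : ∀ x y, f.toFun x = f.toFun y → ∃ z, a.toFun z = x ∧ b.toFun z = y) :
    IsColimit (Cofork.ofπ f w) := by
  -- The descended map is defined through a set-theoretic section; this shows that the choice of
  -- section is immaterial.
  have key (s : Cofork a b) (x : C.carrier) :
      s.π.toFun (Function.surjInv hf.surjective (f.toFun x)) = s.π.toFun x := by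
    obtain ⟨z, hz, rfl⟩ := h _ x (Function.surjInv_eq hf.surjective (f.toFun x))
    rw [← hz]
    exact congr_toFun s.condition z
  refine Cofork.IsColimit.mk _
    (fun s => ⟨fun y => s.π.toFun (Function.surjInv hf.surjective y),
      f.isMorphism.of_comp hf ?_⟩) (fun s => ?_) (fun s m hm => ?_)
  · convert s.π.isMorphism using 1
    exact funext (key s)
  · exact hom_ext (key s)
  · refine hom_ext fun y => ?_
    obtain ⟨x, rfl⟩ := hf.surjective y
    exact (congr_toFun hm x).trans (key s x).symm

/-! ### Image factorization -/

section Image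

variable {C D : Cmp.{u}} (f : C ⟶ D)

/-- The range of a morphism, with the class of maps which lift to an admissible map to the
source. -/
def imagePlotData : Compactology.PlotData.{u, 0} (Set.range f.toFun) where
  ι := Unit
  space _ := D.carrier
  compactology _ := D.compactology
  proj _ := Subtype.val
  ext _ _ h := Subtype.ext (h ⟨⟩)
  IsPlot A _ φ := ∃ ψ : A → C.carrier, C.compactology.Admissible ψ ∧ f.toFun ∘ ψ = Subtype.val ∘ φ
  isEmpty _ _ _ _ :=
    ⟨isEmptyElim, Compactology.admissible_of_isEmpty _, funext fun a => isEmptyElim a⟩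
  const _ _ z := by
    obtain ⟨_, x, rfl⟩ := z
    exact ⟨fun _ => x, Compactology.admissible_const x, rfl⟩
  comp := by
    rintro A B _ _ φ g ⟨ψ, hψ, h⟩ hg
    exact ⟨ψ ∘ g, hψ.comp hg, congrArg (· ∘ g) h⟩
  sumElim := by
    rintro A B _ _ φ φ' ⟨ψ, hψ, h⟩ ⟨ψ', hψ', h'⟩
    refine ⟨Sum.elim ψ ψ', hψ.sumElim hψ', ?_⟩
    rw [Sum.comp_elim, Sum.comp_elim, h, h']
  admissible := by
    rintro A _ φ ⟨ψ, hψ, h⟩ _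
    exact h ▸ f.isMorphism.admissible_comp hψ

/-- The image of a morphism. -/
def image : Cmp.{u} :=
  ⟨Set.range f.toFun, (imagePlotData f).toCompactology⟩

/-- The inclusion of the image. -/
def imageι : image f ⟶ D :=
  ⟨Subtype.val, (imagePlotData f).isMorphism_proj ⟨⟩⟩

/-- The projection onto the image. -/
def toImage : C ⟶ image f :=
  ⟨Set.rangeFactorization f.toFun, (imagePlotData f).isMorphism_of_isPlot fun K hK =>
    ⟨Subtype.val, Compactology.admissible_val K hK, rfl⟩⟩

theorem toImage_imageι : toImage f ≫ imageι f = f :=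
  rfl

instance : Mono (imageι f) :=
  ⟨fun _ _ h => hom_ext fun x => Subtype.ext (congr_toFun h x)⟩

theorem liftsMembers_toImage : LiftsMembers (toImage f) := by
  rintro _ ⟨A, _, _, φ, ⟨ψ, hψ, h⟩, rfl⟩
  refine ⟨_, hψ.range_mem, ?_⟩
  rw [← Set.range_comp]
  congr 1
  exact funext fun a => Subtype.ext (congrFun h a)

end Image

/-! ### Regular epimorphisms and their stability -/

theorem isRegularEpi_iff_liftsMembers {C D : Cmp.{u}} (f : C ⟶ D) :
    IsRegularEpi f ↔ LiftsMembers f := by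
  constructor
  · rintro ⟨⟨r⟩⟩ L hL
    -- As `imageι f` is monic, `toImage f` coequalizes the pair and descends to `s`, a section of
    -- `imageι f`. Lifting `s(L)` along `toImage f` then lifts `L` along `f`.
    obtain ⟨s, hs⟩ := r.desc' (toImage f) (by
      rw [← cancel_mono (imageι f), Category.assoc, Category.assoc, toImage_imageι, r.w])
    have := r.epi
    have hsm : s ≫ imageι f = 𝟙 D := by
      rw [← cancel_epi f, ← Category.assoc, hs, toImage_imageι, Category.comp_id]
    obtain ⟨K, hK, h⟩ := liftsMembers_toImage f _ (s.isMorphism.image_mem L hL)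
    refine ⟨K, hK, ?_⟩
    calc f.toFun '' K = (imageι f).toFun '' ((toImage f).toFun '' K) :=
        Set.image_comp (imageι f).toFun (toImage f).toFun K
      _ = (s ≫ imageι f).toFun '' L := by rw [h]; exact (Set.image_comp _ _ L).symm
      _ = L := by rw [hsm]; exact Set.image_id L
  · exact fun hf => ⟨⟨⟨_, _, _, pullback.condition, hf.isColimit pullback.condition fun _ _ h =>
      exists_of_isPullback (IsPullback.of_hasPullback f f) h⟩⟩⟩

theorem LiftsMembers.of_isPullback {P C D E : Cmp.{u}} {p : P ⟶ C} {q : P ⟶ D} {f : C ⟶ E}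
    {g : D ⟶ E} (h : IsPullback p q f g) (hf : LiftsMembers f) : LiftsMembers q := by
  intro L hL
  obtain ⟨K, hK, hKL⟩ := hf _ (g.isMorphism.image_mem L hL)
  have hM := g.isMorphism.image_mem L hL
  let := C.compactology.top K hK
  let := D.compactology.top L hL
  let := E.compactology.top _ hM
  have := C.compactology.compactSpace K hK
  have := C.compactology.t2Space K hK
  have := D.compactology.compactSpace L hL
  have := D.compactology.t2Space L hL
  have := E.compactology.t2Space _ hM
  have hfK : Continuous fun k : K =>
      (⟨f.toFun k, hKL ▸ Set.mem_image_of_mem _ k.2⟩ : g.toFun '' L) :=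
    (f.isMorphism.admissible_comp
      (Compactology.admissible_val K hK)).continuous_codRestrict _ hM _
  have hgL : Continuous fun l : L => (⟨g.toFun l, Set.mem_image_of_mem _ l.2⟩ : g.toFun '' L) :=
    g.isMorphism.continuous L hL
  let A := {x : K × L // f.toFun x.1 = g.toFun x.2}
  -- The fibre product is an equalizer of continuous maps into the Hausdorff space `g(L)`.
  have hA : IsClosed {x : K × L | f.toFun x.1 = g.toFun x.2} := by
    convert isClosed_eq (hfK.comp continuous_fst) (hgL.comp continuous_snd) using 3
    exact (Subtype.mk_eq_mk).symm
  have : CompactSpace A := isCompact_iff_compactSpace.1 hA.isCompact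
  let a : ofCompactHausdorff A ⟶ C := ofAdmissible (fun x => x.1.1)
    ((Compactology.admissible_val K hK).comp (continuous_fst.comp continuous_subtype_val))
  let b : ofCompactHausdorff A ⟶ D := ofAdmissible (fun x => x.1.2)
    ((Compactology.admissible_val L hL).comp (continuous_snd.comp continuous_subtype_val))
  have hab : a ≫ f = b ≫ g := hom_ext fun x => x.2
  refine ⟨_, (h.lift a b hab).isMorphism.image_mem Set.univ isCompact_univ, ?_⟩
  calc q.toFun '' ((h.lift a b hab).toFun '' Set.univ)
      = (h.lift a b hab ≫ q).toFun '' Set.univ := (Set.image_comp _ _ _).symm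
    _ = b.toFun '' Set.univ := by rw [h.lift_snd]
    _ = L := ?_
  ext y
  constructor
  · rintro ⟨x, -, rfl⟩
    exact x.1.2.2
  · intro hy
    obtain ⟨x, hx, hxy⟩ : g.toFun y ∈ f.toFun '' K := hKL ▸ Set.mem_image_of_mem _ hy
    exact ⟨⟨(⟨x, hx⟩, ⟨y, hy⟩), hxy⟩, trivial, rfl⟩

/-- Since `imageι f` is injective, `f` and `toImage f` identify the same points, so `toImage f` is
the coequalizer. -/
theorem hasCoequalizer_of_isKernelPair {B C D : Cmp.{u}} {f : C ⟶ D} {a b : B ⟶ C}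
    (h : IsKernelPair f a b) : HasCoequalizer a b := by
  have w : a ≫ toImage f = b ≫ toImage f := by
    rw [← cancel_mono (imageι f), Category.assoc, Category.assoc, toImage_imageι, h.w]
  exact ⟨⟨⟨_, (liftsMembers_toImage f).isColimit w fun x y hxy =>
    exists_of_isPullback h (congrArg Subtype.val hxy)⟩⟩⟩

end Cmp

theorem mainTheorem9 : CategoryTheory.Regular Cmp.{u} where
  hasCoequalizer_of_isKernelPair := Cmp.hasCoequalizer_of_isKernelPair
  regularEpiIsStableUnderBaseChange :=
    ⟨fun h hg => (Cmp.isRegularEpi_iff_liftsMembers _).2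
      (.of_isPullback h ((Cmp.isRegularEpi_iff_liftsMembers _).1 hg))⟩
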